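/- **Setting.** Let $Y = XA^* + E$ with a fixed design $X\in\mathbb R^{n\times p}$, $\max_{i,j}|X_{ij}|=1$, $A^*\in\mathbb R^{p\times q}$, and a random $E\in\mathbb R^{n\times q}$ whose rows are independent with mean zero. Assume $A^*=\sum_{k=1}^r\lambda_k^*u_k^*(v_k^*)^{T}$ with orthonormal $u_1^*,\dots,u_r^*\in\mathbb R^p$, orthonormal $v_1^*,\dots,v_r^*\in\mathbb R^q$, each $u_k^*$ having at most $s_u$ and each $v_k^*$ at most $s_v$ nonzero entries. Let $\mathcal S=\{(j,k):A^*_{jk}\neq 0\}$ and $s=|\mathcal S|$. For $\delta>0$ assume $\max_{i,k}\mathbb E|E_{ik}|^{1+\delta}<\infty$; put $v_\delta=\max_{i,k}\mathbb E|E_{ik}|^{1+\delta}$ if $\delta\le 1$, and $v_\delta=\max\{\max_{i,k}\mathbb E|E_{ik}|^{1+\delta},\ \max_{i,k}\mathbb E|E_{ik}|^{2}\}$ if $\delta>1$. For $\tau>0$ let $\ell_\tau(z)=z^2/2$ if $|z|\le\tau$ and $\ell_\tau(z)=\tau|z|-\tau^2/2$ otherwise, and write $\ell_\tau(M)=\sum_{i,k}\ell_\tau(M_{ik})$.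 An estimator $\hat A$ is any minimizer over $A\in\mathbb R^{p\times q}$ of $$\tfrac1n\,\ell_\tau(Y-XA)+\lambda\big(\|A\|_*+\gamma\|A\|_{1,1}\big),$$ where $\|\cdot\|_*$ is the nuclear norm and $\|A\|_{1,1}=\sum_{j,k}|A_{jk}|$. Let $H_\tau(A)=\frac1n\sum_{i=1}^n\mathrm{diag}_k\big(1\{|Y_{ik}-(XA)_{ik}|\le\tau\}\big)\otimes x_ix_i^{T}$ be the Hessian of the loss term in $\mathrm{vec}(A)$, where $x_i^T$ is the $i$th row of $X$. For $m\ge s$, $\xi=(2\gamma+5)/(2\gamma-5)$ and $\eta$, let $\kappa_-$ and $\kappa_+$ be the infimum and the supremum of $\mathrm{vec}(U)^{T}H_\tau(A)\,\mathrm{vec}(U)/\|U\|_F^2$ over all $A,U\in\mathbb R^{p\times q}$ such that $U\ne0$, $\|U_{\mathcal S^c}\|_{1,1}\le\xi\|U_{\mathcal S}\|_{1,1}$, $\|A-A^*\|_{1,1}\le\eta$, and some $J\supseteq\mathcal S$ has $|J|\le m$. The localized restricted eigenvalue condition, with constants $0<\kappa_{\rm lower}\le\kappa_{\rm upper}<\infty$,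 is the (random) event $G=\{\kappa_{\rm lower}/2\le\kappa_-,\ \kappa_+\le\kappa_{\rm upper}\}$. **Theorem 1.** Write $\rho=v_\delta^{1/\min(1+\delta,2)}\big(\frac{\log(pq)}n\big)^{\min\{\delta/(1+\delta),1/2\}}$. There is a universal $C_0>0$ such that the following holds. For all $0<a_1\le b_1$ there is $a_2>0$ (depending only on $a_1,b_1$), for every $\gamma>2.5$ there is $a_3>0$ (depending only on $a_1,b_1,\gamma$), and for every $b_2\ge a_2$ there is $C>0$ (depending only on $a_1,b_1,b_2,\gamma$), such that in the setting above, whenever $$a_1\Big(\frac{nv_\delta}{\log(pq)}\Big)^{1/\min(1+\delta,2)}\le\tau\le b_1\Big(\frac{nv_\delta}{\log(pq)}\Big)^{1/\min(1+\delta,2)},\qquad a_2\,\rho\le\lambda\le b_2\,\rho,$$ $\eta\ge a_3\,\kappa_{\rm lower}^{-1}\lambda s$ and $n>C_0s^2\log(pq)$, the following is true. Outside an event of probability at most $(pq)^{-1}$, if $G$ occurs then every minimizer $\hat A$ satisfies $$\|\hat A-A^*\|_F\le C\,\kappa_{\rm lower}^{-1}\sqrt{r s_us_v}\;\rho,\qquad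 \|\hat A-A^*\|_*\le C\,\kappa_{\rm lower}^{-1}\,r s_us_v\;\rho .$$ Moreover, if $\mathbb P(G)\ge(pq)^{-1}$, then conditionally on $G$ these bounds hold for every minimizer with probability at least $1-(pq)^{-1}$. (Probabilities of possibly non-measurable failure sets are outer probabilities.) -/

import Mathlib

open MeasureTheory ProbabilityTheory
open scoped Kronecker

noncomputable section

namespace RobustRRR

variable {n p q : ℕ}

/-- The Huber loss with robustification parameter `τ`. -/
def huber (τ z : ℝ) : ℝ :=
  if |z| ≤ τ then z ^ 2 / 2 else τ * |z| - τ ^ 2 / 2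

/-- The Huber loss of a matrix: the sum of the losses of its entries. -/
def huberMatrix (τ : ℝ) (M : Matrix (Fin n) (Fin q) ℝ) : ℝ :=
  ∑ i, ∑ k, huber τ (M i k)

/-- The Frobenius norm. -/
def frobNorm (A : Matrix (Fin p) (Fin q) ℝ) : ℝ :=
  Real.sqrt (∑ j, ∑ k, A j k ^ 2)

/-- The entrywise `ℓ₁` norm `‖A‖_{1,1}`. -/
def norm11 (A : Matrix (Fin p) (Fin q) ℝ) : ℝ :=
  ∑ j, ∑ k, |A j k|

/-- `‖A_S‖_{1,1}`: the entrywise `ℓ₁` norm of `A` restricted to the index set `S`. -/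
def norm11On (S : Finset (Fin p × Fin q)) (A : Matrix (Fin p) (Fin q) ℝ) : ℝ :=
  ∑ jk ∈ S, |A jk.1 jk.2|

/-- The nuclear norm: the sum of the `min p q` singular values. -/
def nuclearNorm (A : Matrix (Fin p) (Fin q) ℝ) : ℝ :=
  ∑ k ∈ Finset.range (min p q), (Matrix.toEuclideanLin A).singularValues k

open Classical in
/-- The support of a matrix: the set of the indices of its nonzero entries. -/
def supp (A : Matrix (Fin p) (Fin q) ℝ) : Finset (Fin p × Fin q) :=
  Finset.univ.filter fun jk => A jk.1 jk.2 ≠ 0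

open Classical in
/-- The number of nonzero entries of a vector. -/
def norm0 {d : ℕ} (u : Fin d → ℝ) : ℕ :=
  (Finset.univ.filter fun j => u j ≠ 0).card

/-- `A = U Λ Vᵀ = ∑ₖ Λₖ uₖ vₖᵀ` with `r` orthonormal columns `uₖ` of `U`, each with at most `su`
nonzero entries, and `r` orthonormal columns `vₖ` of `V`, each with at most `sv` nonzero entries. -/
def HasSparseDecomposition (A : Matrix (Fin p) (Fin q) ℝ) (r su sv : ℕ) : Prop :=
  ∃ (U : Matrix (Fin p) (Fin r) ℝ) (Λ : Fin r → ℝ) (V : Matrix (Fin q) (Fin r) ℝ),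
    U.transpose * U = 1 ∧ V.transpose * V = 1 ∧
    (∀ k, norm0 (fun j => U j k) ≤ su) ∧ (∀ k, norm0 (fun j => V j k) ≤ sv) ∧
    A = U * Matrix.diagonal Λ * V.transpose

/-- The penalized objective `n⁻¹ ℓ_τ(Y - X A) + λ (‖A‖_* + γ ‖A‖_{1,1})`. -/
def objective (X : Matrix (Fin n) (Fin p) ℝ) (Y : Matrix (Fin n) (Fin q) ℝ) (τ lam γ : ℝ)
    (A : Matrix (Fin p) (Fin q) ℝ) : ℝ :=
  (n : ℝ)⁻¹ * huberMatrix τ (Y - X * A) + lam * (nuclearNorm A + γ * norm11 A)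

/-- `A` is a global minimizer of the penalized objective. -/
def IsEstimator (X : Matrix (Fin n) (Fin p) ℝ) (Y : Matrix (Fin n) (Fin q) ℝ) (τ lam γ : ℝ)
    (A : Matrix (Fin p) (Fin q) ℝ) : Prop :=
  IsMinOn (objective X Y τ lam γ) Set.univ A

open Classical in
/-- The Hessian of `A ↦ n⁻¹ ℓ_τ(Y - X A)` with respect to `vec A`, namely
`n⁻¹ ∑ᵢ Tᵢ ⊗ xᵢ xᵢᵀ`, where `xᵢ` is the `i`th row of `X` and `Tᵢ` is the diagonal matrix of the
indicators of `|Y_{ik} - (X A)_{ik}| ≤ τ`. -/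
def hessian (X : Matrix (Fin n) (Fin p) ℝ) (Y : Matrix (Fin n) (Fin q) ℝ) (τ : ℝ)
    (A : Matrix (Fin p) (Fin q) ℝ) : Matrix (Fin q × Fin p) (Fin q × Fin p) ℝ :=
  (n : ℝ)⁻¹ • ∑ i,
    (Matrix.diagonal fun k => if |Y i k - (X * A) i k| ≤ τ then (1 : ℝ) else 0) ⊗ₖ
      Matrix.vecMulVec (X i) (X i)

/-- The quotient `vec(U)ᵀ H_τ(A) vec(U) / ‖U‖_F²`. -/
def rayleigh (X : Matrix (Fin n) (Fin p) ℝ) (Y : Matrix (Fin n) (Fin q) ℝ) (τ : ℝ)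
    (A U : Matrix (Fin p) (Fin q) ℝ) : ℝ :=
  (U.vec ⬝ᵥ (hessian X Y τ A).mulVec U.vec) / frobNorm U ^ 2

/-- The local `ℓ_{1,1}`-cone `C(m, ξ, η)` around `Astar`. -/
def localCone (Astar : Matrix (Fin p) (Fin q) ℝ) (m : ℕ) (ξ η : ℝ) :
    Set (Matrix (Fin p) (Fin q) ℝ × Matrix (Fin p) (Fin q) ℝ) :=
  {AU | AU.2 ≠ 0 ∧ (∃ J : Finset (Fin p × Fin q), supp Astar ⊆ J ∧ J.card ≤ m) ∧
    norm11On (supp Astar)ᶜ AU.2 ≤ ξ * norm11On (supp Astar) AU.2 ∧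
    norm11 (AU.1 - Astar) ≤ η}

/-- The minimum localized restricted eigenvalue (an infimum in the extended reals). -/
def kappaMinus (X : Matrix (Fin n) (Fin p) ℝ) (Y : Matrix (Fin n) (Fin q) ℝ)
    (Astar : Matrix (Fin p) (Fin q) ℝ) (τ : ℝ) (m : ℕ) (ξ η : ℝ) : EReal :=
  ⨅ AU ∈ localCone Astar m ξ η, (rayleigh X Y τ AU.1 AU.2 : EReal)

/-- The maximum localized restricted eigenvalue (a supremum in the extended reals). -/
def kappaPlus (X : Matrix (Fin n) (Fin p) ℝ) (Y : Matrix (Fin n) (Fin q) ℝ)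
    (Astar : Matrix (Fin p) (Fin q) ℝ) (τ : ℝ) (m : ℕ) (ξ η : ℝ) : EReal :=
  ⨆ AU ∈ localCone Astar m ξ η, (rayleigh X Y τ AU.1 AU.2 : EReal)

/-- The localized restricted eigenvalue condition with constants `κl` and `κu`. The inequality
`kappaMinus ≤ kappaPlus` is automatic when the local cone is nonempty. -/
def LocalizedRE (X : Matrix (Fin n) (Fin p) ℝ) (Y : Matrix (Fin n) (Fin q) ℝ)
    (Astar : Matrix (Fin p) (Fin q) ℝ) (τ : ℝ) (m : ℕ) (ξ η κl κu : ℝ) : Prop :=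
  ((κl / 2 : ℝ) : EReal) ≤ kappaMinus X Y Astar τ m ξ η ∧
    kappaPlus X Y Astar τ m ξ η ≤ (κu : EReal)

/-- The largest absolute moment of order `a` of an entry of the random matrix `E`. -/
def maxMoment {Ω : Type*} [MeasurableSpace Ω] (μ : Measure Ω)
    (E : Ω → Matrix (Fin n) (Fin q) ℝ) (a : ℝ) : ℝ :=
  ⨆ ik : Fin n × Fin q, ∫ ω, |E ω ik.1 ik.2| ^ a ∂μ

/-- The noise level `v_δ`: the largest `(1+δ)`th absolute moment of an entry if `δ ≤ 1`, and the
larger of this and of the largest second moment if `δ > 1`. -/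
def noiseLevel {Ω : Type*} [MeasurableSpace Ω] (μ : Measure Ω)
    (E : Ω → Matrix (Fin n) (Fin q) ℝ) (δ : ℝ) : ℝ :=
  max (maxMoment μ E (1 + δ)) (maxMoment μ E (min (1 + δ) 2))

/-- The error matrix has independent mean-zero rows, and all its entries have a finite absolute
moment of order `1 + δ`. -/
structure NoiseCondition {Ω : Type*} [MeasurableSpace Ω] (μ : Measure Ω)
    (E : Ω → Matrix (Fin n) (Fin q) ℝ) (δ : ℝ) : Prop where
  measurable : ∀ i k, Measurable fun ω => E ω i k
  indep : iIndepFun (fun (i : Fin n) (ω : Ω) => (fun k => E ω i k : Fin q → ℝ)) μ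
  mean_zero : ∀ i k, ∫ ω, E ω i k ∂μ = 0
  moment : ∀ i k, Integrable (fun ω => |E ω i k| ^ (1 + δ)) μ

/-- The order `(n v / log(pq))^{1 / min(1+δ, 2)}` of the robustification parameter. -/
def tauOrder (n p q : ℕ) (δ v : ℝ) : ℝ :=
  ((n : ℝ) * v / Real.log ((p : ℝ) * q)) ^ (1 / min (1 + δ) 2)

/-- The rate `v^{1 / min(1+δ, 2)} (log(pq) / n)^{min(δ/(1+δ), 1/2)}`. -/
def rate (n p q : ℕ) (δ v : ℝ) : ℝ :=
  v ^ (1 / min (1 + δ) 2) * (Real.log ((p : ℝ) * q) / n) ^ min (δ / (1 + δ)) (1 / 2)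

/-- The error bounds in the Frobenius and in the nuclear norm, with constant `C`. -/
def ErrorBounds (Ahat Astar : Matrix (Fin p) (Fin q) ℝ) (C κl R : ℝ) (r su sv : ℕ) : Prop :=
  frobNorm (Ahat - Astar) ≤ C * (κl⁻¹ * Real.sqrt ((r : ℝ) * su * sv) * R) ∧
    nuclearNorm (Ahat - Astar) ≤ C * (κl⁻¹ * ((r : ℝ) * su * sv) * R)

end RobustRRR

end

/-! The proof separates a deterministic argument from one tail bound. Let W be the estimation error
and suppose every entry of the loss gradient at the truth is at most λ/2 in modulus. Comparing
objectives (`basic_inequality`), the gradient costs (λ/2)‖W‖₁₁, the nuclear penalty costs at most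
λ‖W‖₁₁ because the nuclear norm is dominated by the entrywise ℓ₁ norm, and the ℓ₁ penalty gains λγ
off the support. For γ > 5/2 this puts W in the cone of the eigenvalue condition. The Taylor
remainder of the Huber loss is a weighted integral of the Hessian form along the segment to the
estimator (`bregman_eq_integral`), so restricted eigenvalues give curvature κ‖W‖_F²/4, and
Cauchy–Schwarz on the support yields the rates. Convexity keeps the estimator inside the radius η
(`estimator_bounds`). The sparse decomposition enters only through the size of the support.

The gradient entries are sums of independent clipped errors. A Chernoff bound at 1/τ with a moment
of order min(1+δ, 2) controls variance and clipping bias together (`exp_mul_clip_le`). The constants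
give failure probability (pq)⁻², small enough for both the unconditional and the conditional claim.
-/

namespace RobustRRR

/-! ### Nuclear norm through duality with Bessel families -/

section NuclearNorm

open Module

variable {E F : Type*} [NormedAddCommGroup E] [InnerProductSpace ℝ E]
  [NormedAddCommGroup F] [InnerProductSpace ℝ F]

/-- A finite family that satisfies Bessel's inequality. -/
def IsBessel {ι : Type*} [Fintype ι] (u : ι → E) : Prop :=
  ∀ x, ∑ i, inner ℝ (u i) x ^ 2 ≤ ‖x‖ ^ 2

theorem IsBessel.norm_le_one {ι : Type*} [Fintype ι] {u : ι → E} (hu : IsBessel u) (i : ι) :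
    ‖u i‖ ≤ 1 := by
  have h1 : inner ℝ (u i) (u i) ^ 2 ≤ ‖u i‖ ^ 2 :=
    (Finset.single_le_sum (f := fun j => inner ℝ (u j) (u i) ^ 2)
      (fun j _ => sq_nonneg _) (Finset.mem_univ i)).trans (hu (u i))
  rw [real_inner_self_eq_norm_sq] at h1
  by_contra! h
  have h2 : 1 < ‖u i‖ ^ 2 := one_lt_pow₀ h two_ne_zero
  nlinarith

theorem isBessel_of_orthonormal_ne_zero {ι : Type*} [Fintype ι] {u : ι → E}
    (hu : Orthonormal ℝ fun i : {i // u i ≠ 0} => u i) : IsBessel u := by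
  classical
  intro x
  have h := hu.sum_inner_products_le (x := x) (s := Finset.univ)
  refine le_trans (le_of_eq ?_) h
  simp only [Real.norm_eq_abs, sq_abs]
  rw [← Finset.sum_subtype (Finset.univ.filter fun i => u i ≠ 0) (by simp)
    (fun i => inner ℝ (u i) x ^ 2), Finset.sum_filter_of_ne]
  intro i _ hi h0
  simp [h0] at hi

variable [FiniteDimensional ℝ E] [FiniteDimensional ℝ F]

/-- The right vectors diagonalize T*T and the left ones are their normalized images. Where the
singular value is 0 the left vector is 0, since `0⁻¹ = 0`. This is why the left family is only
Bessel, which avoids completing it to an orthonormal one. -/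
theorem exists_singular_system (T : E →ₗ[ℝ] F) {d : ℕ} (hd : finrank ℝ E = d) :
    ∃ (v : OrthonormalBasis (Fin d) ℝ E) (u : Fin d → F), IsBessel u ∧
      (∀ i, T (v i) = T.singularValues i • u i) ∧
      ∀ i : Fin d, inner ℝ (u i) (T (v i)) = T.singularValues i := by
  set hT := T.isSymmetric_adjoint_comp_self
  set v := hT.eigenvectorBasis hd
  have hin : ∀ i j, inner ℝ (T (v i)) (T (v j)) =
      if i = j then T.singularValues i ^ 2 else 0 := by
    intro i j
    rw [← LinearMap.adjoint_inner_right]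
    have := hT.apply_eigenvectorBasis hd j
    simp only [LinearMap.comp_apply] at this
    rw [this, inner_smul_right, orthonormal_iff_ite.1 v.orthonormal]
    split_ifs with h
    · subst h
      simp [T.sq_singularValues_fin hd]
    · simp
  have hz : ∀ i : Fin d, T.singularValues i = 0 → T (v i) = 0 := by
    intro i hi
    have := hin i i
    rw [if_pos rfl, hi] at this
    simpa using this
  refine ⟨v, fun i => (T.singularValues i)⁻¹ • T (v i), ?_, ?_, ?_⟩
  · apply isBessel_of_orthonormal_ne_zero
    rw [orthonormal_iff_ite]
    rintro ⟨i, hi⟩ ⟨j, hj⟩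
    have h0 : T.singularValues i ≠ 0 := fun h => hi (by simp [h])
    rw [inner_smul_left, inner_smul_right, hin]
    simp only [Subtype.mk.injEq]
    split_ifs with h
    · subst h
      simp
      field_simp
    · simp
  · intro i
    by_cases h : T.singularValues i = 0
    · simp [h, hz i h]
    · rw [smul_smul, mul_inv_cancel₀ h, one_smul]
  · intro i
    by_cases h : T.singularValues i = 0
    · simp [h]
    · rw [inner_smul_left, hin, if_pos rfl]
      simp
      field_simp

/-- Expand each `b i` in the right singular basis. The weight of the k-th singular value is then at
most (‖v k‖² + ‖u k‖²)/2 ≤ 1, by AM-GM and Bessel's inequality for both families. -/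
theorem sum_inner_le_sum_singularValues (T : E →ₗ[ℝ] F) {d : ℕ} (hd : finrank ℝ E = d)
    {ι : Type*} [Fintype ι] {a : ι → F} {b : ι → E} (ha : IsBessel a) (hb : IsBessel b) :
    ∑ i, inner ℝ (a i) (T (b i)) ≤ ∑ k : Fin d, T.singularValues k := by
  obtain ⟨v, u, hu, hTv, -⟩ := exists_singular_system T hd
  have h1 : ∀ i, inner ℝ (a i) (T (b i)) =
      ∑ k : Fin d, T.singularValues k * (inner ℝ (b i) (v k) * inner ℝ (a i) (u k)) := by
    intro i
    conv_lhs => rw [← v.sum_repr' (b i)]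
    rw [map_sum, inner_sum]
    refine Finset.sum_congr rfl fun k _ => ?_
    rw [map_smul, hTv, inner_smul_right, inner_smul_right, real_inner_comm]
    ring
  simp_rw [h1]
  rw [Finset.sum_comm]
  refine Finset.sum_le_sum fun k _ => ?_
  rw [← Finset.mul_sum]
  refine mul_le_of_le_one_right (T.singularValues_nonneg k) ?_
  have h2 : ∀ i, inner ℝ (b i) (v k) * inner ℝ (a i) (u k) ≤
      (inner ℝ (b i) (v k) ^ 2 + inner ℝ (a i) (u k) ^ 2) / 2 := fun i => by
    nlinarith [sq_nonneg (inner ℝ (b i) (v k) - inner ℝ (a i) (u k))]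
  refine (Finset.sum_le_sum fun i _ => h2 i).trans ?_
  rw [← Finset.sum_div, Finset.sum_add_distrib]
  have h3 := hb (v k)
  have h4 := ha (u k)
  have h5 := hu.norm_le_one k
  have h6 : ‖v k‖ = 1 := v.orthonormal.1 k
  have h7 : ‖u k‖ ^ 2 ≤ 1 := pow_le_one₀ (norm_nonneg _) h5
  rw [h6] at h3
  linarith

variable {p q : ℕ}

theorem nuclearNorm_eq_sum_fin (A : Matrix (Fin p) (Fin q) ℝ) :
    nuclearNorm A = ∑ k : Fin q, (Matrix.toEuclideanLin A).singularValues k := by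
  rw [nuclearNorm, Fin.sum_univ_eq_sum_range (fun k => (Matrix.toEuclideanLin A).singularValues k)]
  refine Finset.sum_subset (fun k hk => ?_) fun k _ hk => ?_
  · simp only [Finset.mem_range] at hk ⊢
    omega
  · rw [LinearMap.singularValues_eq_zero_iff_le_finrank_range]
    have h1 := LinearMap.finrank_range_le (Matrix.toEuclideanLin A)
    have h2 := Submodule.finrank_le (Matrix.toEuclideanLin A).range
    simp only [finrank_euclideanSpace, Fintype.card_fin] at h1 h2
    simp only [Finset.mem_range] at hk
    omega

theorem sum_inner_le_nuclearNorm (A : Matrix (Fin p) (Fin q) ℝ) {ι : Type*} [Fintype ι]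
    {a : ι → EuclideanSpace ℝ (Fin p)} {b : ι → EuclideanSpace ℝ (Fin q)}
    (ha : IsBessel a) (hb : IsBessel b) :
    ∑ i, inner ℝ (a i) (Matrix.toEuclideanLin A (b i)) ≤ nuclearNorm A := by
  rw [nuclearNorm_eq_sum_fin]
  exact sum_inner_le_sum_singularValues _ (by simp) ha hb

/-- Singular vectors attain the dual bound. The nuclear norm is thus a maximum of linear
functionals, from which subadditivity, homogeneity and the ℓ₁ bound follow. -/
theorem exists_sum_inner_eq_nuclearNorm (A : Matrix (Fin p) (Fin q) ℝ) :
    ∃ (a : Fin q → EuclideanSpace ℝ (Fin p)) (b : Fin q → EuclideanSpace ℝ (Fin q)),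
      IsBessel a ∧ IsBessel b ∧
      nuclearNorm A = ∑ i, inner ℝ (a i) (Matrix.toEuclideanLin A (b i)) := by
  obtain ⟨v, u, hu, -, h⟩ := exists_singular_system (Matrix.toEuclideanLin A)
    (d := q) (by simp)
  refine ⟨u, v, hu, fun x => ?_, ?_⟩
  · simpa using v.orthonormal.sum_inner_products_le (x := x) (s := Finset.univ)
  · rw [nuclearNorm_eq_sum_fin]
    exact Finset.sum_congr rfl fun i _ => (h i).symm

theorem nuclearNorm_add_le (A B : Matrix (Fin p) (Fin q) ℝ) :
    nuclearNorm (A + B) ≤ nuclearNorm A + nuclearNorm B := by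
  obtain ⟨a, b, ha, hb, h⟩ := exists_sum_inner_eq_nuclearNorm (A + B)
  rw [h]
  simp only [map_add, LinearMap.add_apply, inner_add_right, Finset.sum_add_distrib]
  exact add_le_add (sum_inner_le_nuclearNorm A ha hb) (sum_inner_le_nuclearNorm B ha hb)

theorem nuclearNorm_smul_le {c : ℝ} (hc : 0 ≤ c) (A : Matrix (Fin p) (Fin q) ℝ) :
    nuclearNorm (c • A) ≤ c * nuclearNorm A := by
  obtain ⟨a, b, ha, hb, h⟩ := exists_sum_inner_eq_nuclearNorm (c • A)
  rw [h]
  simp only [map_smul, LinearMap.smul_apply, inner_smul_right, ← Finset.mul_sum]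
  exact mul_le_mul_of_nonneg_left (sum_inner_le_nuclearNorm A ha hb) hc

theorem IsBessel.sum_sq_apply_le_one {ι : Type*} [Fintype ι] {d : ℕ}
    {a : ι → EuclideanSpace ℝ (Fin d)} (ha : IsBessel a) (j : Fin d) :
    ∑ i, a i j ^ 2 ≤ 1 := by
  simpa [EuclideanSpace.inner_single_right] using ha (EuclideanSpace.single j 1)

theorem nuclearNorm_le_norm11 (A : Matrix (Fin p) (Fin q) ℝ) : nuclearNorm A ≤ norm11 A := by
  obtain ⟨a, b, ha, hb, h⟩ := exists_sum_inner_eq_nuclearNorm A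
  have h1 : nuclearNorm A = ∑ j, ∑ k, A j k * ∑ i, a i j * b i k := by
    rw [h]
    have : ∀ i, inner ℝ (a i) (Matrix.toEuclideanLin A (b i)) =
        ∑ j, ∑ k, A j k * (a i j * b i k) := by
      intro i
      simp only [PiLp.inner_apply, Matrix.ofLp_toLpLin, Matrix.toLin'_apply, Matrix.mulVec,
        dotProduct, RCLike.inner_apply, conj_trivial, Finset.sum_mul]
      exact Finset.sum_congr rfl fun j _ => Finset.sum_congr rfl fun k _ => by ring
    simp_rw [this]
    rw [Finset.sum_comm]
    refine Finset.sum_congr rfl fun j _ => ?_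
    rw [Finset.sum_comm]
    exact Finset.sum_congr rfl fun k _ => by rw [Finset.mul_sum]
  rw [h1, norm11]
  -- The dual matrix ∑ᵢ aᵢ bᵢᵀ has entries in [-1, 1]: test Bessel's inequality on coordinate
  -- vectors.
  refine Finset.sum_le_sum fun j _ => Finset.sum_le_sum fun k _ => ?_
  refine (le_abs_self _).trans ?_
  rw [abs_mul]
  refine mul_le_of_le_one_right (abs_nonneg _) ?_
  refine (Finset.abs_sum_le_sum_abs _ _).trans ?_
  have h2 : ∀ i, |a i j * b i k| ≤ (a i j ^ 2 + b i k ^ 2) / 2 := fun i => by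
    rw [abs_mul, ← sq_abs (a i j), ← sq_abs (b i k)]
    nlinarith [sq_nonneg (|a i j| - |b i k|)]
  refine (Finset.sum_le_sum fun i _ => h2 i).trans ?_
  rw [← Finset.sum_div, Finset.sum_add_distrib]
  linarith [ha.sum_sq_apply_le_one j, hb.sum_sq_apply_le_one k]

end NuclearNorm

end RobustRRR

noncomputable section

namespace RobustRRR

/-! ### Calculus of the Huber loss -/

section Huber

/-- The derivative of the Huber loss: truncation at the level `τ`. -/
def clip (τ z : ℝ) : ℝ := max (-τ) (min τ z)

variable {τ : ℝ}

theorem clip_of_abs_le {z : ℝ} (h : |z| ≤ τ) : clip τ z = z := by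
  rw [abs_le] at h
  rw [clip, min_eq_right h.2, max_eq_right h.1]

theorem clip_of_lt (hτ : 0 < τ) {z : ℝ} (h : τ < z) : clip τ z = τ := by
  rw [clip, min_eq_left h.le, max_eq_right (by linarith)]

theorem clip_of_lt_neg {z : ℝ} (h : z < -τ) : clip τ z = -τ := by
  rw [clip, max_eq_left ((min_le_right _ _).trans h.le)]

theorem continuous_clip : Continuous (clip τ) := by
  unfold clip
  fun_prop

theorem abs_clip_le (hτ : 0 < τ) (z : ℝ) : |clip τ z| ≤ τ :=
  abs_le.2 ⟨le_max_left _ _, max_le (by linarith) (min_le_left _ _)⟩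

/-- One expression in `clip` covers both branches, so regularity of the loss reduces to that of the
truncation. -/
theorem huber_eq (hτ : 0 < τ) (z : ℝ) : huber τ z = clip τ z * z - clip τ z ^ 2 / 2 := by
  unfold huber
  split_ifs with h
  · rw [clip_of_abs_le h]
    ring
  · rw [not_le, lt_abs] at h
    rcases h with h | h
    · rw [clip_of_lt hτ h, abs_of_pos (hτ.trans h)]
    · rw [clip_of_lt_neg (by linarith), abs_of_neg (by linarith)]
      ring

theorem continuous_huber (hτ : 0 < τ) : Continuous (huber τ) := by
  rw [funext (huber_eq hτ)]
  have := continuous_clip (τ := τ)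
  fun_prop

theorem hasDerivAt_clip (hτ : 0 < τ) {z : ℝ} (hz : |z| ≠ τ) :
    HasDerivAt (clip τ) (if |z| ≤ τ then 1 else 0) z := by
  split_ifs with h
  · have h1 : |z| < τ := lt_of_le_of_ne h hz
    refine (hasDerivAt_id z).congr_of_eventuallyEq ?_
    filter_upwards [continuous_abs.continuousAt.eventually_lt continuousAt_const h1] with y hy
    exact clip_of_abs_le hy.le
  · rw [not_le, lt_abs] at h
    rcases h with h | h
    · refine (hasDerivAt_const z τ).congr_of_eventuallyEq ?_
      filter_upwards [eventually_gt_nhds h] with y hy using clip_of_lt hτ hy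
    · refine (hasDerivAt_const z (-τ)).congr_of_eventuallyEq ?_
      filter_upwards [eventually_lt_nhds (show z < -τ by linarith)] with y hy using
        clip_of_lt_neg hy

theorem hasDerivAt_huber (hτ : 0 < τ) {z : ℝ} (hz : |z| ≠ τ) :
    HasDerivAt (huber τ) (clip τ z) z := by
  rw [funext (huber_eq hτ)]
  have h := hasDerivAt_clip hτ hz
  refine ((h.mul (hasDerivAt_id z)).sub ((h.pow 2).div_const 2)).congr_deriv ?_
  split_ifs with h1
  · simp [clip_of_abs_le h1]
  · simp

theorem intervalIntegrable_taylor_remainder (e d : ℝ) :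
    IntervalIntegrable (fun u => (1 - u) * if |e - u * d| ≤ τ then d ^ 2 else 0)
      volume 0 1 := by
  rw [intervalIntegrable_iff_integrableOn_Ioc_of_le zero_le_one]
  refine Measure.integrableOn_of_bounded (M := d ^ 2) (by simp) ?_ ?_
  · refine Measurable.aestronglyMeasurable ?_
    refine Measurable.mul (by fun_prop) (Measurable.ite ?_ (by fun_prop) (by fun_prop))
    exact measurableSet_le (by fun_prop) (by fun_prop)
  · refine (ae_restrict_iff' measurableSet_Ioc).2 (Filter.Eventually.of_forall fun u hu => ?_)
    rw [norm_mul, Real.norm_eq_abs, Real.norm_eq_abs, abs_of_nonneg (by linarith [hu.2])]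
    split_ifs
    · rw [abs_of_nonneg (sq_nonneg d)]
      exact mul_le_of_le_one_left (sq_nonneg d) (by linarith [hu.1])
    · simp [sq_nonneg]

/-- Taylor's formula for the Huber loss with the remainder in integral form. -/
theorem huber_taylor (hτ : 0 < τ) (e d : ℝ) :
    huber τ (e - d) - huber τ e + d * clip τ e =
      ∫ u in (0 : ℝ)..1, (1 - u) * if |e - u * d| ≤ τ then d ^ 2 else 0 := by
  by_cases hd : d = 0
  · simp [hd]
  -- For d ≠ 0 the segment meets the kinks ±τ at most twice. The fundamental theorem of calculus
  -- tolerates this countable exceptional set.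
  have hs : {u : ℝ | |e - u * d| = τ}.Countable := by
    refine Set.Countable.mono (s₂ := {(e - τ) / d, (e + τ) / d}) (fun u hu => ?_) (by simp)
    rw [Set.mem_ofPred_eq, abs_eq hτ.le] at hu
    rcases hu with hu | hu
    · left
      field_simp
      linarith
    · right
      simp only [Set.mem_singleton_iff]
      field_simp
      linarith
  -- In the derivative of this primitive the first-order terms ∓d·`clip` cancel, leaving the
  -- weighted indicator.
  have h := MeasureTheory.integral_eq_of_hasDerivAt_off_countable
    (fun u => huber τ (e - u * d) - (1 - u) * d * clip τ (e - u * d))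
    (fun u => (1 - u) * if |e - u * d| ≤ τ then d ^ 2 else 0) hs ?_ ?_
    (intervalIntegrable_taylor_remainder e d)
  · rw [h]
    simp
    ring
  · have h1 := continuous_clip (τ := τ)
    have h2 := continuous_huber hτ
    fun_prop
  · intro u hu
    have hl : HasDerivAt (fun u : ℝ => e - u * d) (-d) u := by
      simpa using ((hasDerivAt_id u).mul_const d).const_sub e
    have h1 := (hasDerivAt_huber hτ hu.2).comp u hl
    have h2 := (hasDerivAt_clip hτ hu.2).comp u hl
    have h3 : HasDerivAt (fun u : ℝ => (1 - u) * d) (-d) u := by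
      simpa using ((hasDerivAt_id u).const_sub 1).mul_const d
    refine (h1.sub (h3.mul h2)).congr_deriv ?_
    simp only [Function.comp_apply]
    split_ifs <;> ring

theorem huber_subgradient (hτ : 0 < τ) (x y : ℝ) :
    huber τ x + clip τ x * (y - x) ≤ huber τ y := by
  have h := huber_taylor hτ x (x - y)
  have h0 : 0 ≤ ∫ u in (0 : ℝ)..1,
      (1 - u) * if |x - u * (x - y)| ≤ τ then (x - y) ^ 2 else 0 := by
    refine intervalIntegral.integral_nonneg zero_le_one fun u hu => ?_
    refine mul_nonneg (by linarith [hu.2]) ?_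
    split_ifs <;> positivity
  rw [← h, sub_sub_cancel] at h0
  linarith

theorem huber_convex (hτ : 0 < τ) (x y : ℝ) {t : ℝ} (h0 : 0 ≤ t) (h1 : t ≤ 1) :
    huber τ ((1 - t) * x + t * y) ≤ (1 - t) * huber τ x + t * huber τ y := by
  set z := (1 - t) * x + t * y
  have hx := mul_le_mul_of_nonneg_left (huber_subgradient hτ z x) (sub_nonneg.2 h1)
  have hy := mul_le_mul_of_nonneg_left (huber_subgradient hτ z y) h0
  have : (1 - t) * (clip τ z * (x - z)) + t * (clip τ z * (y - z)) = 0 := by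
    simp only [z]
    ring
  linarith

end Huber

/-! ### First-order expansion and Hessian of the matrix loss -/

section Loss

variable {n p q : ℕ} {τ : ℝ}

theorem vec_dotProduct_hessian_mulVec (X : Matrix (Fin n) (Fin p) ℝ)
    (Y : Matrix (Fin n) (Fin q) ℝ) (A U : Matrix (Fin p) (Fin q) ℝ) :
    U.vec ⬝ᵥ (hessian X Y τ A).mulVec U.vec =
      (n : ℝ)⁻¹ * ∑ i, ∑ k, if |Y i k - (X * A) i k| ≤ τ then (X * U) i k ^ 2 else 0 := by
  rw [hessian, Matrix.smul_mulVec, dotProduct_smul, smul_eq_mul, Matrix.sum_mulVec,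
    dotProduct_sum]
  congr 1
  refine Finset.sum_congr rfl fun i _ => ?_
  simp only [dotProduct, Matrix.mulVec, Matrix.kroneckerMap_apply, Fintype.sum_prod_type,
    Matrix.vec, Matrix.diagonal_apply, Matrix.vecMulVec_apply]
  refine Finset.sum_congr rfl fun k _ => ?_
  have h1 : ∀ j, (∑ k', ∑ j', (if k = k' then if |Y i k - (X * A) i k| ≤ τ then (1 : ℝ) else 0
      else 0) * (X i j * X i j') * U j' k') =
      if |Y i k - (X * A) i k| ≤ τ then X i j * ∑ j', X i j' * U j' k else 0 := by
    intro j
    rw [Finset.sum_eq_single k]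
    · simp only [if_true]
      split_ifs
      · simp only [one_mul, Finset.mul_sum, mul_assoc]
      · simp
    · intro k' _ hk
      simp [hk.symm]
    · simp
  simp_rw [h1]
  split_ifs
  · rw [sq, Matrix.mul_apply, Finset.sum_mul]
    exact Finset.sum_congr rfl fun j _ => by ring
  · simp

/-- The entries of minus the gradient of the loss `n⁻¹ ℓ_τ(E)`. -/
def score (X : Matrix (Fin n) (Fin p) ℝ) (E : Matrix (Fin n) (Fin q) ℝ) (τ : ℝ)
    (j : Fin p) (k : Fin q) : ℝ :=
  (n : ℝ)⁻¹ * ∑ i, X i j * clip τ (E i k)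

theorem sum_mul_score (X : Matrix (Fin n) (Fin p) ℝ) (E : Matrix (Fin n) (Fin q) ℝ)
    (W : Matrix (Fin p) (Fin q) ℝ) :
    ∑ j, ∑ k, W j k * score X E τ j k = (n : ℝ)⁻¹ * ∑ i, ∑ k, (X * W) i k * clip τ (E i k) := by
  simp only [score, Matrix.mul_apply, Finset.mul_sum, Finset.sum_mul]
  rw [Finset.sum_comm]
  conv_rhs => rw [Finset.sum_comm]
  refine Finset.sum_congr rfl fun k _ => ?_
  rw [Finset.sum_comm]
  exact Finset.sum_congr rfl fun i _ => Finset.sum_congr rfl fun j _ => by ring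

/-- The remainder of the first-order expansion of the loss. -/
def bregman (X : Matrix (Fin n) (Fin p) ℝ) (E : Matrix (Fin n) (Fin q) ℝ) (τ : ℝ)
    (W : Matrix (Fin p) (Fin q) ℝ) : ℝ :=
  (n : ℝ)⁻¹ * huberMatrix τ (E - X * W) - (n : ℝ)⁻¹ * huberMatrix τ E +
    ∑ j, ∑ k, W j k * score X E τ j k

theorem bregman_eq_integral (hτ : 0 < τ) (X : Matrix (Fin n) (Fin p) ℝ)
    (E : Matrix (Fin n) (Fin q) ℝ) (W : Matrix (Fin p) (Fin q) ℝ) :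
    bregman X E τ W = ∫ u in (0 : ℝ)..1, (1 - u) * ((n : ℝ)⁻¹ * ∑ i, ∑ k,
      if |E i k - u * (X * W) i k| ≤ τ then (X * W) i k ^ 2 else 0) := by
  have h1 : ∀ u : ℝ, (1 - u) * ((n : ℝ)⁻¹ * ∑ i, ∑ k,
      if |E i k - u * (X * W) i k| ≤ τ then (X * W) i k ^ 2 else 0) =
      (n : ℝ)⁻¹ * ∑ i, ∑ k,
        (1 - u) * if |E i k - u * (X * W) i k| ≤ τ then (X * W) i k ^ 2 else 0 := by
    intro u
    simp only [← Finset.mul_sum]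
    ring
  simp_rw [h1]
  rw [intervalIntegral.integral_const_mul, intervalIntegral.integral_finsetSum]
  · rw [bregman, sum_mul_score, ← mul_sub, ← mul_add]
    congr 1
    simp only [huberMatrix, ← Finset.sum_sub_distrib, ← Finset.sum_add_distrib]
    refine Finset.sum_congr rfl fun i _ => ?_
    rw [intervalIntegral.integral_finsetSum]
    · exact Finset.sum_congr rfl fun k _ => huber_taylor hτ _ _
    · exact fun k _ => intervalIntegrable_taylor_remainder _ _
  · intro i _
    have := IntervalIntegrable.sum Finset.univ
      (f := fun k u => (1 - u) * if |E i k - u * (X * W) i k| ≤ τ then (X * W) i k ^ 2 else 0)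
      (μ := volume) (a := 0) (b := 1) fun k _ => intervalIntegrable_taylor_remainder _ _
    simpa [Finset.sum_fn] using this

theorem bregman_nonneg (hτ : 0 < τ) (X : Matrix (Fin n) (Fin p) ℝ)
    (E : Matrix (Fin n) (Fin q) ℝ) (W : Matrix (Fin p) (Fin q) ℝ) : 0 ≤ bregman X E τ W := by
  rw [bregman_eq_integral hτ]
  refine intervalIntegral.integral_nonneg zero_le_one fun u hu => ?_
  refine mul_nonneg (by linarith [hu.2]) (mul_nonneg (by positivity) ?_)
  refine Finset.sum_nonneg fun i _ => Finset.sum_nonneg fun k _ => ?_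
  split_ifs <;> positivity

/-- The weight 1 - u has integral 1/2 over [0, 1], hence the halving. -/
theorem le_bregman (hτ : 0 < τ) (X : Matrix (Fin n) (Fin p) ℝ)
    (E : Matrix (Fin n) (Fin q) ℝ) (W : Matrix (Fin p) (Fin q) ℝ) {c : ℝ}
    (h : ∀ u ∈ Set.Icc (0 : ℝ) 1, c ≤ (n : ℝ)⁻¹ * ∑ i, ∑ k,
      if |E i k - u * (X * W) i k| ≤ τ then (X * W) i k ^ 2 else 0) :
    c / 2 ≤ bregman X E τ W := by
  have hc : ∫ u in (0 : ℝ)..1, (1 - u) * c = c / 2 := by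
    rw [intervalIntegral.integral_mul_const, intervalIntegral.integral_sub (by simp) (by simp)]
    simp
    ring
  rw [bregman_eq_integral hτ, ← hc]
  refine intervalIntegral.integral_mono_on zero_le_one
    (Continuous.intervalIntegrable (by fun_prop) _ _) ?_ fun u hu =>
      mul_le_mul_of_nonneg_left (h u hu) (by linarith [hu.2])
  have h1 : (fun u : ℝ => (1 - u) * ((n : ℝ)⁻¹ * ∑ i, ∑ k,
      if |E i k - u * (X * W) i k| ≤ τ then (X * W) i k ^ 2 else 0)) = fun u =>
      (n : ℝ)⁻¹ * (∑ i, ∑ k, fun u : ℝ =>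
        (1 - u) * if |E i k - u * (X * W) i k| ≤ τ then (X * W) i k ^ 2 else 0) u := by
    ext u
    simp only [Finset.sum_apply, ← Finset.mul_sum]
    ring
  rw [h1]
  exact (IntervalIntegrable.sum _ fun i _ => IntervalIntegrable.sum _ fun k _ =>
    intervalIntegrable_taylor_remainder _ _).const_mul _

end Loss

end RobustRRR

end

namespace RobustRRR

/-! ### Deterministic error bounds -/

section Deterministic

variable {n p q : ℕ}

theorem norm11_eq_sum (A : Matrix (Fin p) (Fin q) ℝ) :
    norm11 A = ∑ jk : Fin p × Fin q, |A jk.1 jk.2| := by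
  rw [norm11, Fintype.sum_prod_type]

theorem norm11On_add_compl (S : Finset (Fin p × Fin q)) (A : Matrix (Fin p) (Fin q) ℝ) :
    norm11On S A + norm11On Sᶜ A = norm11 A := by
  rw [norm11_eq_sum, norm11On, norm11On, Finset.sum_add_sum_compl]

theorem norm11On_nonneg (S : Finset (Fin p × Fin q)) (A : Matrix (Fin p) (Fin q) ℝ) :
    0 ≤ norm11On S A :=
  Finset.sum_nonneg fun _ _ => abs_nonneg _

theorem norm11_smul (c : ℝ) (A : Matrix (Fin p) (Fin q) ℝ) : norm11 (c • A) = |c| * norm11 A := by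
  simp [norm11, abs_mul, Finset.mul_sum]

theorem norm11_neg (A : Matrix (Fin p) (Fin q) ℝ) : norm11 (-A) = norm11 A := by
  simp [norm11]

theorem norm11_add_le (A B : Matrix (Fin p) (Fin q) ℝ) :
    norm11 (A + B) ≤ norm11 A + norm11 B := by
  simp only [norm11, ← Finset.sum_add_distrib, Matrix.add_apply]
  exact Finset.sum_le_sum fun j _ => Finset.sum_le_sum fun k _ => abs_add_le _ _

/-- Off the support A vanishes, so W counts there in full; on it the reverse triangle inequality
applies. -/
theorem norm11_sub_norm11_add_le (A W : Matrix (Fin p) (Fin q) ℝ) :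
    norm11 A - norm11 (A + W) ≤ norm11On (supp A) W - norm11On (supp A)ᶜ W := by
  rw [← norm11On_add_compl (supp A) A, ← norm11On_add_compl (supp A) (A + W)]
  have h1 : norm11On (supp A) A - norm11On (supp A) (A + W) ≤ norm11On (supp A) W := by
    simp only [norm11On, ← Finset.sum_sub_distrib]
    refine Finset.sum_le_sum fun jk _ => ?_
    have := abs_sub_abs_le_abs_sub (A jk.1 jk.2) ((A + W) jk.1 jk.2)
    simpa using this
  have h0 : ∀ jk ∈ (supp A)ᶜ, A jk.1 jk.2 = 0 := by
    intro jk hjk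
    simpa [supp] using hjk
  have h2 : norm11On (supp A)ᶜ A = 0 :=
    Finset.sum_eq_zero fun jk hjk => by rw [h0 jk hjk, abs_zero]
  have h3 : norm11On (supp A)ᶜ (A + W) = norm11On (supp A)ᶜ W :=
    Finset.sum_congr rfl fun jk hjk => by rw [Matrix.add_apply, h0 jk hjk, zero_add]
  rw [h2, h3]
  linarith

theorem frobNorm_nonneg (A : Matrix (Fin p) (Fin q) ℝ) : 0 ≤ frobNorm A := Real.sqrt_nonneg _

theorem sq_frobNorm (A : Matrix (Fin p) (Fin q) ℝ) :
    frobNorm A ^ 2 = ∑ jk : Fin p × Fin q, A jk.1 jk.2 ^ 2 := by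
  rw [frobNorm, Real.sq_sqrt, Fintype.sum_prod_type]
  exact Finset.sum_nonneg fun j _ => Finset.sum_nonneg fun k _ => sq_nonneg _

theorem norm11On_le_sqrt_card_mul_frobNorm (S : Finset (Fin p × Fin q))
    (A : Matrix (Fin p) (Fin q) ℝ) : norm11On S A ≤ √(S.card : ℝ) * frobNorm A := by
  refine abs_le_of_sq_le_sq' ?_ (mul_nonneg (Real.sqrt_nonneg _) (frobNorm_nonneg A)) |>.2
  rw [mul_pow, Real.sq_sqrt (by positivity), norm11On]
  refine sq_sum_le_card_mul_sum_sq.trans (mul_le_mul_of_nonneg_left ?_ (by positivity))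
  simp only [sq_abs]
  rw [sq_frobNorm]
  exact Finset.sum_le_sum_of_subset_of_nonneg (Finset.subset_univ _) fun _ _ _ => sq_nonneg _

theorem sq_frobNorm_pos {A : Matrix (Fin p) (Fin q) ℝ} (hA : A ≠ 0) : 0 < frobNorm A ^ 2 := by
  rw [sq_frobNorm]
  obtain ⟨j, k, h⟩ : ∃ j k, A j k ≠ 0 := by
    by_contra! h
    exact hA (Matrix.ext h)
  exact Finset.sum_pos' (fun _ _ => sq_nonneg _) ⟨(j, k), Finset.mem_univ _, by positivity⟩

theorem frobNorm_zero : frobNorm (0 : Matrix (Fin p) (Fin q) ℝ) = 0 := by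
  simp [frobNorm]

theorem objective_convex (X : Matrix (Fin n) (Fin p) ℝ) (Y : Matrix (Fin n) (Fin q) ℝ)
    {τ lam γ : ℝ} (hτ : 0 < τ) (hlam : 0 ≤ lam) (hγ : 0 ≤ γ) (A W : Matrix (Fin p) (Fin q) ℝ)
    {t : ℝ} (h0 : 0 ≤ t) (h1 : t ≤ 1) :
    objective X Y τ lam γ (A + t • W) ≤
      (1 - t) * objective X Y τ lam γ A + t * objective X Y τ lam γ (A + W) := by
  have hA : A + t • W = (1 - t) • A + t • (A + W) := by
    rw [sub_smul, one_smul, smul_add]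
    abel
  have hl : huberMatrix τ (Y - X * (A + t • W)) ≤
      (1 - t) * huberMatrix τ (Y - X * A) + t * huberMatrix τ (Y - X * (A + W)) := by
    simp only [huberMatrix, Finset.mul_sum, ← Finset.sum_add_distrib]
    refine Finset.sum_le_sum fun i _ => Finset.sum_le_sum fun k _ => ?_
    refine le_trans (le_of_eq ?_) (huber_convex hτ _ _ h0 h1)
    congr 1
    simp only [Matrix.mul_add, Matrix.mul_smul, Matrix.sub_apply, Matrix.add_apply,
      Matrix.smul_apply, smul_eq_mul]
    ring
  have hN : nuclearNorm (A + t • W) ≤ (1 - t) * nuclearNorm A + t * nuclearNorm (A + W) := by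
    rw [hA]
    exact (nuclearNorm_add_le _ _).trans (add_le_add (nuclearNorm_smul_le (by linarith) _)
      (nuclearNorm_smul_le h0 _))
  have h11 : norm11 (A + t • W) ≤ (1 - t) * norm11 A + t * norm11 (A + W) := by
    rw [hA]
    refine (norm11_add_le _ _).trans (le_of_eq ?_)
    rw [norm11_smul, norm11_smul, abs_of_nonneg h0, abs_of_nonneg (sub_nonneg.2 h1)]
  have e1 := mul_le_mul_of_nonneg_left hl (by positivity : 0 ≤ (n : ℝ)⁻¹)
  have e2 := mul_le_mul_of_nonneg_left (add_le_add hN (mul_le_mul_of_nonneg_left h11 hγ)) hlam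
  simp only [objective]
  linarith

variable {X : Matrix (Fin n) (Fin p) ℝ} {E : Matrix (Fin n) (Fin q) ℝ}
  {Astar W : Matrix (Fin p) (Fin q) ℝ} {τ lam γ : ℝ}

/-- The basic inequality of a perturbation that does not increase the objective. -/
theorem basic_inequality (hlam : 0 ≤ lam)
    (hscore : ∀ j k, |score X E τ j k| ≤ lam / 2)
    (hW : objective X (X * Astar + E) τ lam γ (Astar + W) ≤
      objective X (X * Astar + E) τ lam γ Astar) (hγ : 0 ≤ γ) :
    bregman X E τ W + lam * ((γ - 3 / 2) * norm11On (supp Astar)ᶜ W) ≤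
      lam * ((γ + 3 / 2) * norm11On (supp Astar) W) := by
  have hs : ∑ j, ∑ k, W j k * score X E τ j k ≤ lam / 2 * norm11 W := by
    rw [norm11, Finset.mul_sum]
    refine Finset.sum_le_sum fun j _ => ?_
    rw [Finset.mul_sum]
    refine Finset.sum_le_sum fun k _ => (le_abs_self _).trans ?_
    rw [abs_mul, mul_comm]
    exact mul_le_mul_of_nonneg_right (hscore j k) (abs_nonneg _)
  -- The nuclear penalty is treated as a perturbation paid for in ℓ₁ norm. Together with the 1/2
  -- from the score this produces the shift 3/2 in γ ± 3/2.
  have hN : nuclearNorm Astar ≤ nuclearNorm (Astar + W) + norm11 W := by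
    have h1 := nuclearNorm_add_le (Astar + W) (-W)
    have h2 := nuclearNorm_le_norm11 (-W)
    rw [norm11_neg] at h2
    rw [add_neg_cancel_right] at h1
    linarith
  have h11 := norm11_sub_norm11_add_le Astar W
  have hsum := norm11On_add_compl (supp Astar) W
  have r1 : X * Astar + E - X * (Astar + W) = E - X * W := by
    rw [Matrix.mul_add]
    abel
  have r2 : X * Astar + E - X * Astar = E := by abel
  simp only [objective, r1, r2] at hW
  have e1 := mul_le_mul_of_nonneg_left hN hlam
  have e2 := mul_le_mul_of_nonneg_left (mul_le_mul_of_nonneg_left h11 hγ) hlam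
  rw [bregman]
  rw [← hsum] at hs e1
  linarith

variable {m : ℕ} {η κl : ℝ}

/-- Every point `Astar + u • W` of the segment stays within ℓ₁ distance η, so the eigenvalue bound
applies to the direction W all along it. The zero direction lies outside the cone and is handled
apart. -/
theorem le_bregman_of_rayleigh (hτ : 0 < τ) {ξ : ℝ} (hm : (supp Astar).card ≤ m)
    (hRE : ∀ A U, (A, U) ∈ localCone Astar m ξ η → κl / 2 ≤ rayleigh X (X * Astar + E) τ A U)
    (hcone : norm11On (supp Astar)ᶜ W ≤ ξ * norm11On (supp Astar) W) (hη : norm11 W ≤ η) :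
    κl / 4 * frobNorm W ^ 2 ≤ bregman X E τ W := by
  by_cases h0 : W = 0
  · rw [h0, frobNorm_zero]
    simpa using bregman_nonneg hτ X E 0
  have hpos := sq_frobNorm_pos h0
  have := le_bregman hτ X E W (c := κl / 2 * frobNorm W ^ 2) ?_
  · linarith
  intro u hu
  have hmem : (Astar + u • W, W) ∈ localCone Astar m ξ η := by
    refine ⟨h0, ⟨_, subset_rfl, hm⟩, hcone, ?_⟩
    simp only [add_sub_cancel_left, norm11_smul]
    rw [abs_of_nonneg hu.1]
    exact (mul_le_of_le_one_left (Finset.sum_nonneg fun _ _ =>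
      Finset.sum_nonneg fun _ _ => abs_nonneg _) hu.2).trans hη
  have h := hRE _ _ hmem
  rw [rayleigh, le_div_iff₀ hpos, vec_dotProduct_hessian_mulVec] at h
  refine h.trans (le_of_eq ?_)
  congr 1
  refine Finset.sum_congr rfl fun i _ => Finset.sum_congr rfl fun k _ => ?_
  have : (X * Astar + E) i k - (X * (Astar + u • W)) i k = E i k - u * (X * W) i k := by
    simp only [Matrix.mul_add, Matrix.mul_smul, Matrix.add_apply, Matrix.smul_apply, smul_eq_mul]
    ring
  rw [this]

/-- The bounds for a perturbation in the local region that does not increase the objective. -/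
theorem local_bounds (hτ : 0 < τ) (hlam : 0 < lam) (hγ : 5 / 2 < γ) (hκ : 0 < κl)
    (hscore : ∀ j k, |score X E τ j k| ≤ lam / 2)
    (hm : (supp Astar).card ≤ m)
    (hRE : ∀ A U, (A, U) ∈ localCone Astar m ((2 * γ + 5) / (2 * γ - 5)) η →
      κl / 2 ≤ rayleigh X (X * Astar + E) τ A U)
    (hW : objective X (X * Astar + E) τ lam γ (Astar + W) ≤
      objective X (X * Astar + E) τ lam γ Astar) :
    norm11 W ≤ (1 + (2 * γ + 5) / (2 * γ - 5)) * norm11On (supp Astar) W ∧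
    (norm11 W ≤ η → frobNorm W ≤ 4 * (γ + 3 / 2) * κl⁻¹ * lam * √((supp Astar).card : ℝ) ∧
      norm11On (supp Astar) W ≤
        4 * (γ + 3 / 2) * κl⁻¹ * lam * ((supp Astar).card : ℝ)) := by
  have hb := basic_inequality hlam.le hscore hW (by linarith)
  have h0 := bregman_nonneg hτ X E W
  have hS := norm11On_nonneg (supp Astar) W
  have hSc := norm11On_nonneg (supp Astar)ᶜ W
  have hcone' : (γ - 3 / 2) * norm11On (supp Astar)ᶜ W ≤
      (γ + 3 / 2) * norm11On (supp Astar) W :=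
    le_of_mul_le_mul_left (by linarith) hlam
  have hcone : norm11On (supp Astar)ᶜ W ≤
      (2 * γ + 5) / (2 * γ - 5) * norm11On (supp Astar) W := by
    have h1 : (γ + 3 / 2) / (γ - 3 / 2) ≤ (2 * γ + 5) / (2 * γ - 5) := by
      rw [div_le_div_iff₀ (by linarith) (by linarith)]
      nlinarith
    refine le_trans ?_ (mul_le_mul_of_nonneg_right h1 hS)
    rw [div_mul_eq_mul_div, le_div_iff₀ (by linarith)]
    linarith
  refine ⟨by rw [← norm11On_add_compl (supp Astar) W]; linarith, fun hη => ?_⟩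
  have hbreg := le_bregman_of_rayleigh hτ hm hRE hcone hη
  have hC := norm11On_le_sqrt_card_mul_frobNorm (supp Astar) W
  set F := frobNorm W
  set s := √((supp Astar).card : ℝ)
  have hs : 0 ≤ s := Real.sqrt_nonneg _
  have hF0 : 0 ≤ F := frobNorm_nonneg W
  have hss : s * s = ((supp Astar).card : ℝ) := Real.mul_self_sqrt (by positivity)
  have hF : F ≤ 4 * (γ + 3 / 2) * κl⁻¹ * lam * s := by
    rcases hF0.eq_or_lt with h | h
    · rw [← h]
      have : 0 ≤ γ + 3 / 2 := by linarith
      positivity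
    -- Quadratic curvature against a linear penalty: one factor F cancels.
    · have h1 : κl / 4 * F ^ 2 ≤ lam * ((γ + 3 / 2) * (s * F)) := by
        have h2 : 0 ≤ lam * ((γ - 3 / 2) * norm11On (supp Astar)ᶜ W) :=
          mul_nonneg hlam.le (mul_nonneg (by linarith) hSc)
        have h3 : lam * ((γ + 3 / 2) * norm11On (supp Astar) W) ≤
            lam * ((γ + 3 / 2) * (s * F)) :=
          mul_le_mul_of_nonneg_left (mul_le_mul_of_nonneg_left hC (by linarith)) hlam.le
        linarith
      have h2 : κl / 4 * F ≤ lam * ((γ + 3 / 2) * s) :=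
        le_of_mul_le_mul_right (by linarith) h
      have h3 : 4 * (γ + 3 / 2) * κl⁻¹ * lam * s = 4 * (lam * ((γ + 3 / 2) * s)) / κl := by
        field_simp
      rw [h3, le_div_iff₀ hκ]
      linarith
  refine ⟨hF, hC.trans ?_⟩
  rw [← hss]
  calc s * F ≤ s * (4 * (γ + 3 / 2) * κl⁻¹ * lam * s) := mul_le_mul_of_nonneg_left hF hs
    _ = _ := by ring

/-- If the error left the ℓ₁ ball of radius η, shrinking it to the sphere would, by convexity, still
not increase the objective. The local bounds then apply to the shrunken error and contradict its
norm being η. -/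
theorem estimator_bounds (hτ : 0 < τ) (hlam : 0 < lam) (hγ : 5 / 2 < γ) (hκ : 0 < κl)
    (hscore : ∀ j k, |score X E τ j k| ≤ lam / 2)
    (hm : (supp Astar).card ≤ m)
    (hRE : ∀ A U, (A, U) ∈ localCone Astar m ((2 * γ + 5) / (2 * γ - 5)) η →
      κl / 2 ≤ rayleigh X (X * Astar + E) τ A U)
    (hη : ((1 + (2 * γ + 5) / (2 * γ - 5)) * (4 * (γ + 3 / 2)) + 1) *
      (κl⁻¹ * lam * ((supp Astar).card : ℝ)) ≤ η)
    {Ahat : Matrix (Fin p) (Fin q) ℝ} (hA : IsEstimator X (X * Astar + E) τ lam γ Ahat) :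
    frobNorm (Ahat - Astar) ≤ 4 * (γ + 3 / 2) * κl⁻¹ * lam * √((supp Astar).card : ℝ) ∧
    norm11 (Ahat - Astar) ≤ (1 + (2 * γ + 5) / (2 * γ - 5)) *
      (4 * (γ + 3 / 2) * κl⁻¹ * lam * ((supp Astar).card : ℝ)) := by
  set D := Ahat - Astar
  set ξ := (2 * γ + 5) / (2 * γ - 5)
  have hξ : 0 ≤ ξ := div_nonneg (by linarith) (by linarith)
  have hD : objective X (X * Astar + E) τ lam γ (Astar + D) ≤
      objective X (X * Astar + E) τ lam γ Astar := by
    rw [add_sub_cancel]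
    exact hA (Set.mem_univ Astar)
  have hγ' : 0 ≤ γ + 3 / 2 := by linarith
  have hc : 0 ≤ κl⁻¹ * lam * ((supp Astar).card : ℝ) := by positivity
  have hη0 : 0 ≤ η := le_trans (by positivity) hη
  obtain ⟨h1, h2⟩ := local_bounds hτ hlam hγ hκ hscore hm hRE hD
  suffices h : norm11 D ≤ η by
    obtain ⟨h3, h4⟩ := h2 h
    exact ⟨h3, h1.trans (mul_le_mul_of_nonneg_left h4 (by positivity))⟩
  by_contra! h
  have hDpos : 0 < norm11 D := hη0.trans_lt h
  set t := η / norm11 D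
  have ht0 : 0 ≤ t := div_nonneg hη0 hDpos.le
  have ht1 : t ≤ 1 := (div_le_one hDpos).2 h.le
  have hW : objective X (X * Astar + E) τ lam γ (Astar + t • D) ≤
      objective X (X * Astar + E) τ lam γ Astar := by
    have := objective_convex X (X * Astar + E) hτ hlam.le (by linarith : 0 ≤ γ) Astar D ht0 ht1
    have := mul_le_mul_of_nonneg_left hD ht0
    linarith
  have htD : norm11 (t • D) = η := by
    rw [norm11_smul, abs_of_nonneg ht0, div_mul_cancel₀ _ hDpos.ne']
  obtain ⟨h5, h6⟩ := local_bounds hτ hlam hγ hκ hscore hm hRE hW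
  have h7 := mul_le_mul_of_nonneg_left (h6 htD.le).2 (by positivity : 0 ≤ 1 + ξ)
  -- The `+ 1` in `hη` makes η exceed the local bound strictly unless this product is 0. In that
  -- case the support is empty and the cone inequality forces `norm11 D = 0`.
  have h8 : κl⁻¹ * lam * ((supp Astar).card : ℝ) = 0 := by
    rw [htD] at h5
    linarith
  have h9 : (supp Astar).card = 0 := by
    have : κl⁻¹ * lam ≠ 0 := by positivity
    simpa [this] using h8
  have h10 : norm11On (supp Astar) D = 0 := by
    rw [Finset.card_eq_zero] at h9
    rw [h9, norm11On, Finset.sum_empty]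
  rw [h10, mul_zero] at h1
  linarith

/-- A nonzero entry needs a nonzero summand, so the support is covered by r rectangles of size at
most su × sv. -/
theorem card_supp_le {r su sv : ℕ} (h : HasSparseDecomposition Astar r su sv) :
    (supp Astar).card ≤ r * su * sv := by
  classical
  obtain ⟨U, Λ, V, -, -, hU, hV, rfl⟩ := h
  have hsub : supp (U * Matrix.diagonal Λ * V.transpose) ⊆
      Finset.univ.biUnion fun k => (Finset.univ.filter fun j => U j k ≠ 0) ×ˢ
        (Finset.univ.filter fun j => V j k ≠ 0) := by
    rintro ⟨i, j⟩ hij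
    simp only [supp, Finset.mem_filter, Finset.mem_univ, true_and] at hij
    rw [Matrix.mul_apply] at hij
    obtain ⟨k, -, hk⟩ := Finset.exists_ne_zero_of_sum_ne_zero hij
    rw [Matrix.mul_diagonal, Matrix.transpose_apply] at hk
    have h1 := left_ne_zero_of_mul hk
    simp only [Finset.mem_biUnion, Finset.mem_univ, true_and, Finset.mem_product,
      Finset.mem_filter]
    exact ⟨k, left_ne_zero_of_mul h1, right_ne_zero_of_mul hk⟩
  refine (Finset.card_le_card hsub).trans (Finset.card_biUnion_le.trans ?_)
  calc _ ≤ ∑ _k : Fin r, su * sv := Finset.sum_le_sum fun k _ => by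
        rw [Finset.card_product]
        refine Nat.mul_le_mul ?_ ?_
        · exact (Finset.card_le_card fun j => by simp).trans (hU k)
        · exact (Finset.card_le_card fun j => by simp).trans (hV k)
    _ = r * su * sv := by simp [mul_assoc]

end Deterministic

end RobustRRR

namespace RobustRRR

/-! ### Concentration of the score -/

section Score

/-- Start from exp y ≤ 1 + y + y² for |y| ≤ 1. If |z| ≤ τ there is no bias, and y² ≤ (|z|/τ)^α as α
≤ 2. Otherwise the bias is at most |z|/τ - 1 and y² ≤ 1, with total |z|/τ ≤ (|z|/τ)^α as α ≥ 1. -/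
theorem exp_mul_clip_le {τ α x : ℝ} (hτ : 0 < τ) (h1 : 1 ≤ α) (h2 : α ≤ 2) (hx : |x| ≤ 1)
    (z : ℝ) :
    Real.exp (τ⁻¹ * (x * clip τ z)) ≤ 1 + x / τ * z + |z| ^ α * τ ^ (-α) := by
  set y := τ⁻¹ * (x * clip τ z)
  have hc := abs_clip_le hτ z
  have hyc : |y| ≤ |clip τ z| / τ := by
    rw [abs_mul, abs_mul, abs_of_pos (inv_pos.2 hτ), inv_mul_eq_div]
    gcongr
    exact mul_le_of_le_one_left (abs_nonneg _) hx
  have hy : |y| ≤ 1 := hyc.trans ((div_le_one hτ).2 hc)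
  have hexp : Real.exp y ≤ 1 + y + y ^ 2 := by
    have := (abs_le.1 (Real.abs_exp_sub_one_sub_id_le hy)).2
    linarith
  refine hexp.trans ?_
  have hpow : |z| ^ α * τ ^ (-α) = (|z| / τ) ^ α := by
    rw [Real.div_rpow (abs_nonneg _) hτ.le, Real.rpow_neg hτ.le, div_eq_mul_inv]
  rw [hpow]
  by_cases hz : |z| ≤ τ
  · rw [clip_of_abs_le hz] at hyc
    have hy2 : y ^ 2 ≤ (|z| / τ) ^ (2 : ℝ) := by
      rw [Real.rpow_two, ← sq_abs y]
      exact pow_le_pow_left₀ (abs_nonneg _) hyc 2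
    have h3 : (|z| / τ) ^ (2 : ℝ) ≤ (|z| / τ) ^ α := by
      rcases (abs_nonneg z).eq_or_lt with h | h
      · rw [← h, zero_div, Real.zero_rpow (by norm_num), Real.zero_rpow (by linarith)]
      · exact Real.rpow_le_rpow_of_exponent_ge (by positivity) ((div_le_one hτ).2 hz) h2
    have h4 : y = x / τ * z := by
      simp only [y, clip_of_abs_le hz]
      ring
    linarith
  · rw [not_le] at hz
    have h3 : |z| / τ ≤ (|z| / τ) ^ α := by
      conv_lhs => rw [← Real.rpow_one (|z| / τ)]
      exact Real.rpow_le_rpow_of_exponent_le ((one_le_div hτ).2 hz.le) h1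
    have hy2 : y ^ 2 ≤ 1 := by
      rw [← sq_abs]
      exact pow_le_one₀ (abs_nonneg _) hy
    have hdiff : |clip τ z - z| = |z| - τ := by
      rcases lt_abs.1 hz with h | h
      · rw [clip_of_lt hτ h, abs_of_neg (by linarith), abs_of_pos (by linarith)]
        ring
      · rw [clip_of_lt_neg (by linarith), abs_of_pos (by linarith), abs_of_neg (by linarith)]
        ring
    have h5 : y - x / τ * z ≤ |z| / τ - 1 := by
      have : y - x / τ * z = x * (clip τ z - z) / τ := by
        simp only [y]
        field_simp
      rw [this, div_sub_one hτ.ne', ← hdiff]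
      gcongr
      refine (le_abs_self _).trans ?_
      rw [abs_mul]
      exact mul_le_of_le_one_left (abs_nonneg _) hx
    linarith

variable {Ω : Type*} [MeasurableSpace Ω] {μ : Measure Ω} [IsProbabilityMeasure μ]

theorem measurable_clip (τ : ℝ) : Measurable (clip τ) := continuous_clip.measurable

theorem integrable_exp_mul_clip {τ : ℝ} (hτ : 0 < τ) (c x : ℝ) {f : Ω → ℝ} (hf : Measurable f) :
    Integrable (fun ω => Real.exp (c * (x * clip τ (f ω)))) μ := by
  have hm : Measurable fun ω => clip τ (f ω) := (measurable_clip τ).comp hf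
  refine Integrable.of_bound (Real.measurable_exp.comp
    ((hm.const_mul x).const_mul c)).aestronglyMeasurable (Real.exp (|c| * (|x| * τ)))
    (Filter.Eventually.of_forall fun ω => ?_)
  rw [Real.norm_eq_abs, Real.abs_exp, Real.exp_le_exp]
  refine (le_abs_self _).trans ?_
  rw [abs_mul, abs_mul]
  gcongr
  exact abs_clip_le hτ _

theorem mgf_mul_clip_le {τ α x v : ℝ} (hτ : 0 < τ) (h1 : 1 ≤ α) (h2 : α ≤ 2) (hx : |x| ≤ 1)
    {f : Ω → ℝ} (hf : Measurable f) (hint : Integrable f μ) (hmean : ∫ ω, f ω ∂μ = 0)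
    (hα : Integrable (fun ω => |f ω| ^ α) μ) (hv : ∫ ω, |f ω| ^ α ∂μ ≤ v) :
    mgf (fun ω => x * clip τ (f ω)) μ τ⁻¹ ≤ Real.exp (v * τ ^ (-α)) := by
  have hi : Integrable (fun ω => 1 + x / τ * f ω + |f ω| ^ α * τ ^ (-α)) μ :=
    ((integrable_const 1).add (hint.const_mul _)).add (hα.mul_const _)
  have h3 : mgf (fun ω => x * clip τ (f ω)) μ τ⁻¹ ≤
      ∫ ω, (1 + x / τ * f ω + |f ω| ^ α * τ ^ (-α)) ∂μ :=
    integral_mono (integrable_exp_mul_clip hτ _ _ hf) hi fun ω => exp_mul_clip_le hτ h1 h2 hx _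
  have h6 : Integrable (fun ω => 1 + x / τ * f ω) μ :=
    (integrable_const 1).add (hint.const_mul _)
  rw [integral_add h6 (hα.mul_const _), integral_add (integrable_const 1) (hint.const_mul _),
    integral_const_mul, hmean, integral_mul_const] at h3
  have h4 := mul_le_mul_of_nonneg_right hv (Real.rpow_nonneg hτ.le (-α))
  have h5 := Real.add_one_le_exp (v * τ ^ (-α))
  simp at h3
  linarith

/-- Chernoff's bound with parameter 1/τ, the scale at which the clipped summands are bounded by 1.
-/
theorem measure_sum_mul_clip_ge_le {n : ℕ} {τ α v ε : ℝ} (hτ : 0 < τ) (h1 : 1 ≤ α) (h2 : α ≤ 2)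
    {x : Fin n → ℝ} (hx : ∀ i, |x i| ≤ 1) {f : Fin n → Ω → ℝ} (hf : ∀ i, Measurable (f i))
    (hindep : iIndepFun f μ) (hint : ∀ i, Integrable (f i) μ) (hmean : ∀ i, ∫ ω, f i ω ∂μ = 0)
    (hα : ∀ i, Integrable (fun ω => |f i ω| ^ α) μ) (hv : ∀ i, ∫ ω, |f i ω| ^ α ∂μ ≤ v) :
    μ.real {ω | ε ≤ ∑ i, x i * clip τ (f i ω)} ≤
      Real.exp (-(τ⁻¹ * ε) + n * (v * τ ^ (-α))) := by
  set g : Fin n → Ω → ℝ := fun i ω => x i * clip τ (f i ω)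
  have hg : ∀ i, Measurable (g i) := fun i =>
    ((measurable_clip τ).comp (hf i)).const_mul (x i)
  have hgi : iIndepFun g μ :=
    hindep.comp (fun i z => x i * clip τ z) fun i => (measurable_clip τ).const_mul (x i)
  have hexp : Integrable (fun ω => Real.exp (τ⁻¹ * (∑ i, g i) ω)) μ :=
    hgi.integrable_exp_mul_sum hg fun i _ => integrable_exp_mul_clip hτ _ _ (hf i)
  have h := measure_ge_le_exp_mul_mgf ε (inv_pos.2 hτ).le hexp
  simp only [Finset.sum_apply] at h
  refine h.trans ?_
  rw [hgi.mgf_sum hg, Real.exp_add, ← neg_mul]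
  gcongr
  calc ∏ i, mgf (g i) μ τ⁻¹ ≤ ∏ _i : Fin n, Real.exp (v * τ ^ (-α)) :=
        Finset.prod_le_prod (fun _ _ => mgf_nonneg) fun i _ =>
          mgf_mul_clip_le hτ h1 h2 (hx i) (hf i) (hint i) (hmean i) (hα i) (hv i)
    _ = Real.exp (n * (v * τ ^ (-α))) := by simp [← Real.exp_nat_mul]

variable {n p q : ℕ} {E : Ω → Matrix (Fin n) (Fin q) ℝ} {δ : ℝ}

theorem integrable_rpow_abs_of_le {f : Ω → ℝ} (hf : Measurable f) {a b : ℝ} (ha : 0 ≤ a)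
    (hab : a ≤ b) (h : Integrable (fun ω => |f ω| ^ b) μ) :
    Integrable (fun ω => |f ω| ^ a) μ := by
  refine Integrable.mono' ((integrable_const 1).add h)
    (Measurable.aestronglyMeasurable (by fun_prop)) (Filter.Eventually.of_forall fun ω => ?_)
  rw [Real.norm_eq_abs, abs_of_nonneg (by positivity)]
  simp only [Pi.add_apply]
  rcases le_total |f ω| 1 with h1 | h1
  · have := Real.rpow_le_one (abs_nonneg (f ω)) h1 ha
    have : 0 ≤ |f ω| ^ b := by positivity
    linarith
  · have := Real.rpow_le_rpow_of_exponent_le h1 hab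
    linarith

theorem integral_le_noiseLevel (μ : Measure Ω) (E : Ω → Matrix (Fin n) (Fin q) ℝ) (δ : ℝ)
    (i : Fin n) (k : Fin q) :
    ∫ ω, |E ω i k| ^ min (1 + δ) 2 ∂μ ≤ noiseLevel μ E δ :=
  (le_ciSup (f := fun ik : Fin n × Fin q => ∫ ω, |E ω ik.1 ik.2| ^ min (1 + δ) 2 ∂μ)
    (Set.finite_range _).bddAbove (i, k)).trans (le_max_right _ _)

theorem noiseLevel_nonneg (μ : Measure Ω) (E : Ω → Matrix (Fin n) (Fin q) ℝ) (δ : ℝ) :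
    0 ≤ noiseLevel μ E δ :=
  (Real.iSup_nonneg fun _ => integral_nonneg fun _ =>
    Real.rpow_nonneg (abs_nonneg _) _).trans (le_max_left _ _)

theorem measure_score_gt_le {X : Matrix (Fin n) (Fin p) ℝ} (hX : ∀ i j, |X i j| ≤ 1)
    (hE : NoiseCondition μ E δ) (hδ : 0 < δ) (hn : 0 < n) {τ ε L : ℝ} (hτ : 0 < τ)
    (hL : 4 * L + n * (noiseLevel μ E δ * τ ^ (-min (1 + δ) 2)) ≤ τ⁻¹ * (n * ε)) :
    μ {ω | ∃ j k, ε < |score X (E ω) τ j k|} ≤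
      ENNReal.ofReal ((p : ℝ) * q * (2 * Real.exp (-(4 * L)))) := by
  have hα1 : 1 ≤ min (1 + δ) 2 := le_min (by linarith) (by norm_num)
  have hind : ∀ k, iIndepFun (fun i ω => E ω i k) μ := fun k =>
    hE.indep.comp (fun _ z => z k) fun _ => measurable_pi_apply k
  have hint : ∀ i k, Integrable (fun ω => E ω i k) μ := by
    intro i k
    have := integrable_rpow_abs_of_le (hE.measurable i k) zero_le_one
      (by linarith : (1 : ℝ) ≤ 1 + δ) (hE.moment i k)
    simp only [Real.rpow_one] at this
    exact (integrable_norm_iff (hE.measurable i k).aestronglyMeasurable).1 this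
  have htail : ∀ (x : Fin n → ℝ) (k : Fin q), (∀ i, |x i| ≤ 1) →
      μ {ω | (n : ℝ) * ε ≤ ∑ i, x i * clip τ (E ω i k)} ≤
        ENNReal.ofReal (Real.exp (-(4 * L))) := by
    intro x k hx
    rw [← ENNReal.ofReal_toReal (measure_ne_top μ _)]
    refine ENNReal.ofReal_le_ofReal ?_
    refine (measure_sum_mul_clip_ge_le hτ hα1 (min_le_right _ _) hx
      (fun i => hE.measurable i k) (hind k) (fun i => hint i k) (fun i => hE.mean_zero i k)
      (fun i => integrable_rpow_abs_of_le (hE.measurable i k) (by linarith) (min_le_left _ _)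
        (hE.moment i k)) (fun i => integral_le_noiseLevel μ E δ i k)).trans ?_
    rw [Real.exp_le_exp]
    linarith
  -- The lower tail is the upper tail for the design column with its sign reversed, giving 2pq
  -- events.
  have hsub : {ω | ∃ j k, ε < |score X (E ω) τ j k|} ⊆ ⋃ jk : Fin p × Fin q,
      ({ω | (n : ℝ) * ε ≤ ∑ i, X i jk.1 * clip τ (E ω i jk.2)} ∪
        {ω | (n : ℝ) * ε ≤ ∑ i, (-X i jk.1) * clip τ (E ω i jk.2)}) := by
    rintro ω ⟨j, k, h⟩
    refine Set.mem_iUnion.2 ⟨(j, k), ?_⟩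
    have hn' : (0 : ℝ) < n := by exact_mod_cast hn
    rw [score, abs_mul, abs_of_pos (inv_pos.2 hn'), inv_mul_eq_div, lt_div_iff₀ hn', mul_comm,
      lt_abs, ← Finset.sum_neg_distrib] at h
    simp only [← neg_mul] at h
    exact h.imp le_of_lt le_of_lt
  refine (measure_mono hsub).trans ((measure_iUnion_fintype_le μ _).trans ?_)
  calc _ ≤ ∑ _jk : Fin p × Fin q, ENNReal.ofReal (2 * Real.exp (-(4 * L))) := by
        refine Finset.sum_le_sum fun jk _ => (measure_union_le _ _).trans ?_
        rw [two_mul, ENNReal.ofReal_add (by positivity) (by positivity)]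
        exact add_le_add (htail _ _ fun i => hX i _)
          (htail _ _ fun i => by rw [abs_neg]; exact hX i _)
    _ = _ := by
        rw [Finset.sum_const, nsmul_eq_mul, Finset.card_univ, Fintype.card_prod, Fintype.card_fin,
          Fintype.card_fin, Nat.cast_mul, ENNReal.ofReal_mul (p := (p : ℝ) * q) (by positivity),
          ENNReal.ofReal_mul (Nat.cast_nonneg p), ENNReal.ofReal_natCast, ENNReal.ofReal_natCast]

end Score

/-! ### Orders of the tuning parameters -/

section Rates

variable {n p q : ℕ} {δ v : ℝ}

theorem min_div_eq_one_sub (hδ : 0 < δ) :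
    min (δ / (1 + δ)) (1 / 2) = 1 - 1 / min (1 + δ) 2 := by
  rcases le_total δ 1 with h | h
  · rw [min_eq_left (by linarith : 1 + δ ≤ 2), min_eq_left]
    · field_simp
      ring
    · rw [div_le_div_iff₀ (by linarith) (by norm_num)]
      linarith
  · rw [min_eq_right (by linarith : 2 ≤ 1 + δ), min_eq_right]
    · norm_num
    · rw [div_le_div_iff₀ (by norm_num) (by linarith)]
      linarith

/-- In each degenerate case the base is 0, with `x / 0 = 0` when the logarithm vanishes, and 0 to a
positive power is 0. -/
theorem pos_of_tauOrder_pos (hδ : 0 < δ) (hv : 0 ≤ v) (h : 0 < tauOrder n p q δ v) :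
    0 < (n : ℝ) ∧ 0 < v ∧ 0 < Real.log ((p : ℝ) * q) := by
  have hα : 0 < min (1 + δ) 2 := lt_min (by linarith) (by norm_num)
  have hL : 0 ≤ Real.log ((p : ℝ) * q) := by
    exact_mod_cast Real.log_natCast_nonneg (p * q)
  have h0 : (n : ℝ) * v / Real.log ((p : ℝ) * q) ≠ 0 := by
    intro h0
    rw [tauOrder, h0, Real.zero_rpow (by positivity)] at h
    exact h.false
  refine ⟨?_, ?_, ?_⟩
  · refine lt_of_le_of_ne (by positivity) fun h => h0 ?_
    simp [← h]
  · refine lt_of_le_of_ne hv fun h => h0 ?_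
    simp [← h]
  · refine lt_of_le_of_ne hL fun h => h0 ?_
    simp [← h]

/-- This balance is what fixes the rate: a deviation of order log(pq) at Chernoff scale 1/τ costs τ
log(pq)/n in the score. -/
theorem mul_rate_eq (hδ : 0 < δ) (hn : 0 < (n : ℝ)) (hv : 0 < v)
    (hL : 0 < Real.log ((p : ℝ) * q)) :
    n * rate n p q δ v = Real.log ((p : ℝ) * q) * tauOrder n p q δ v := by
  set L := Real.log ((p : ℝ) * q)
  rw [rate, tauOrder, min_div_eq_one_sub hδ, Real.rpow_sub (by positivity), Real.rpow_one,
    Real.div_rpow hL.le hn.le, Real.div_rpow (by positivity) hL.le, Real.mul_rpow hn.le hv.le]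
  have h1 : 0 < L ^ (1 / min (1 + δ) 2) := Real.rpow_pos_of_pos hL _
  have h2 : 0 < (n : ℝ) ^ (1 / min (1 + δ) 2) := Real.rpow_pos_of_pos hn _
  field_simp
  rfl

theorem mul_rpow_neg_le {a τ : ℝ} (ha : 0 < a) (hδ : 0 < δ) (hn : 0 < (n : ℝ)) (hv : 0 < v)
    (hL : 0 < Real.log ((p : ℝ) * q)) (hτ : a * tauOrder n p q δ v ≤ τ) :
    n * (v * τ ^ (-min (1 + δ) 2)) ≤ (1 + a⁻¹ ^ 2) * Real.log ((p : ℝ) * q) := by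
  set L := Real.log ((p : ℝ) * q)
  set α := min (1 + δ) 2
  have hα : 0 < α := lt_min (by linarith) (by norm_num)
  have hT : 0 < tauOrder n p q δ v := Real.rpow_pos_of_pos (by positivity) _
  have hTα : tauOrder n p q δ v ^ α = n * v / L := by
    rw [tauOrder, ← Real.rpow_mul (by positivity), one_div_mul_cancel hα.ne', Real.rpow_one]
  have h1 : τ ^ (-α) ≤ (a * tauOrder n p q δ v) ^ (-α) :=
    Real.rpow_le_rpow_of_nonpos (by positivity) hτ (by linarith)
  have h2 : (a * tauOrder n p q δ v) ^ (-α) = a⁻¹ ^ α * (L / (n * v)) := by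
    rw [Real.mul_rpow ha.le hT.le, Real.rpow_neg hT.le, hTα, Real.rpow_neg ha.le,
      Real.inv_rpow ha.le, inv_div]
  -- The exponent α depends on δ; this bound makes the constant uniform in it.
  have h3 : a⁻¹ ^ α ≤ 1 + a⁻¹ ^ 2 := by
    rcases le_total a⁻¹ 1 with h | h
    · have := Real.rpow_le_one (by positivity) h hα.le
      have : 0 ≤ a⁻¹ ^ 2 := by positivity
      linarith
    · have := Real.rpow_le_rpow_of_exponent_le h (min_le_right (1 + δ) 2)
      rw [Real.rpow_two] at this
      linarith
  calc n * (v * τ ^ (-α)) ≤ n * (v * (a⁻¹ ^ α * (L / (n * v)))) := by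
        rw [← h2]
        gcongr
    _ = a⁻¹ ^ α * L := by field_simp
    _ ≤ _ := by gcongr

end Rates

end RobustRRR

/-! ### Assembly of constants and probabilities -/

namespace RobustRRR

/-- A positive logarithm forces N ≥ 2, which absorbs the factor 2 in 2N⁻³ ≤ N⁻². -/
theorem two_mul_exp_neg_four_mul_log_le {N : ℕ} (h : 0 < Real.log (N : ℝ)) :
    (N : ℝ) * (2 * Real.exp (-(4 * Real.log (N : ℝ)))) ≤ (N : ℝ)⁻¹ * (N : ℝ)⁻¹ := by
  have h2 : (2 : ℝ) ≤ N := by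
    have h1 : 1 < (N : ℝ) := (Real.log_pos_iff (Nat.cast_nonneg N)).1 h
    exact_mod_cast h1
  have h0 : (0 : ℝ) < N := by linarith
  have he : Real.exp (-(4 * Real.log (N : ℝ))) = ((N : ℝ) ^ 4)⁻¹ := by
    rw [Real.exp_neg, mul_comm, Real.exp_mul, Real.exp_log h0]
    norm_num
  rw [he]
  have : (N : ℝ) * (2 * ((N : ℝ) ^ 4)⁻¹) = 2 / N * ((N : ℝ)⁻¹ * (N : ℝ)⁻¹) := by
    field_simp
  rw [this]
  exact mul_le_of_le_one_left (by positivity) ((div_le_one h0).2 h2)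

theorem LocalizedRE.le_rayleigh {n p q m : ℕ} {X : Matrix (Fin n) (Fin p) ℝ}
    {Y : Matrix (Fin n) (Fin q) ℝ} {Astar : Matrix (Fin p) (Fin q) ℝ} {τ ξ η κl κu : ℝ}
    (h : LocalizedRE X Y Astar τ m ξ η κl κu) (A U : Matrix (Fin p) (Fin q) ℝ)
    (hAU : (A, U) ∈ localCone Astar m ξ η) : κl / 2 ≤ rayleigh X Y τ A U :=
  EReal.coe_le_coe_iff.1 (h.1.trans (iInf₂_le (A, U) hAU))

/-- The nuclear error is bounded by the ℓ₁ error. The Frobenius bound is inflated by 1 + ξ so that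
one constant serves both. -/
theorem errorBounds_of_bounds {p q r su sv : ℕ} {Ahat Astar : Matrix (Fin p) (Fin q) ℝ}
    {K ξ b κl lam R : ℝ} (hK : 0 ≤ K) (hξ : 0 ≤ ξ) (hκ : 0 < κl) (hlam : 0 < lam)
    (hR : lam ≤ b * R) (hs : (supp Astar).card ≤ r * su * sv)
    (hF : frobNorm (Ahat - Astar) ≤ K * κl⁻¹ * lam * √((supp Astar).card : ℝ))
    (h11 : norm11 (Ahat - Astar) ≤ (1 + ξ) * (K * κl⁻¹ * lam * ((supp Astar).card : ℝ))) :
    ErrorBounds Ahat Astar ((1 + ξ) * K * b) κl R r su sv := by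
  have hs' : ((supp Astar).card : ℝ) ≤ (r : ℝ) * su * sv := by exact_mod_cast hs
  have hbR : 0 ≤ b * R := hlam.le.trans hR
  constructor
  · calc frobNorm (Ahat - Astar) ≤ K * κl⁻¹ * lam * √((supp Astar).card : ℝ) := hF
      _ ≤ (1 + ξ) * (K * κl⁻¹ * lam * √((supp Astar).card : ℝ)) :=
        le_mul_of_one_le_left (by positivity) (by linarith)
      _ ≤ (1 + ξ) * (K * κl⁻¹ * (b * R) * √((r : ℝ) * su * sv)) := by gcongr
      _ = _ := by ring
  · calc nuclearNorm (Ahat - Astar) ≤ norm11 (Ahat - Astar) := nuclearNorm_le_norm11 _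
      _ ≤ (1 + ξ) * (K * κl⁻¹ * lam * ((supp Astar).card : ℝ)) := h11
      _ ≤ (1 + ξ) * (K * κl⁻¹ * (b * R) * ((r : ℝ) * su * sv)) := by gcongr
      _ = _ := by ring

end RobustRRR

theorem theorem1 :
    ∃ C₀ : ℝ, 0 < C₀ ∧
    -- the constants of the two-sided order of the robustification parameter
    ∀ a₁ b₁ : ℝ, 0 < a₁ → a₁ ≤ b₁ →
    -- the lower constant for the regularization parameter
    ∃ a₂ : ℝ, 0 < a₂ ∧
    ∀ γ : ℝ, 5 / 2 < γ →
    -- the constant for the radius of the local cone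
    ∃ a₃ : ℝ, 0 < a₃ ∧
    -- the upper constant for the regularization parameter
    ∀ b₂ : ℝ, a₂ ≤ b₂ →
    -- the constant of the error bounds
    ∃ C : ℝ, 0 < C ∧
    ∀ (n p q r su sv m : ℕ) (X : Matrix (Fin n) (Fin p) ℝ) (Astar : Matrix (Fin p) (Fin q) ℝ)
      (Ω : Type*) [MeasurableSpace Ω] (μ : Measure Ω) [IsProbabilityMeasure μ]
      (E : Ω → Matrix (Fin n) (Fin q) ℝ) (δ τ lam η κl κu : ℝ),
    IsGreatest (Set.range fun ij : Fin n × Fin p => |X ij.1 ij.2|) 1 →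
    RobustRRR.HasSparseDecomposition Astar r su sv →
    (RobustRRR.supp Astar).card ≤ m →
    0 < δ →
    RobustRRR.NoiseCondition μ E δ →
    0 < τ →
    a₁ * RobustRRR.tauOrder n p q δ (RobustRRR.noiseLevel μ E δ) ≤ τ →
    τ ≤ b₁ * RobustRRR.tauOrder n p q δ (RobustRRR.noiseLevel μ E δ) →
    a₂ * RobustRRR.rate n p q δ (RobustRRR.noiseLevel μ E δ) ≤ lam →
    lam ≤ b₂ * RobustRRR.rate n p q δ (RobustRRR.noiseLevel μ E δ) →
    0 < κl →
    κl ≤ κu →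
    a₃ * (κl⁻¹ * lam * ((RobustRRR.supp Astar).card : ℝ)) ≤ η →
    C₀ * ((RobustRRR.supp Astar).card : ℝ) ^ 2 * Real.log ((p : ℝ) * q) < n →
    -- the event that the localized restricted eigenvalue condition holds
    let G : Set Ω := {ω | RobustRRR.LocalizedRE X (X * Astar + E ω) Astar τ m
      ((2 * γ + 5) / (2 * γ - 5)) η κl κu}
    -- the event that some solution violates one of the two error bounds
    let B : Set Ω := {ω | ∃ Ahat : Matrix (Fin p) (Fin q) ℝ,
      RobustRRR.IsEstimator X (X * Astar + E ω) τ lam γ Ahat ∧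
      ¬ RobustRRR.ErrorBounds Ahat Astar C κl
        (RobustRRR.rate n p q δ (RobustRRR.noiseLevel μ E δ)) r su sv}
    μ (G ∩ B) ≤ ENNReal.ofReal (((p : ℝ) * q)⁻¹) ∧
    (ENNReal.ofReal (((p : ℝ) * q)⁻¹) ≤ μ G →
      μ (G ∩ B) ≤ ENNReal.ofReal (((p : ℝ) * q)⁻¹) * μ G) := by
  refine ⟨1, one_pos, fun a₁ b₁ ha₁ hab₁ => ?_⟩
  have hb₁ : 0 < b₁ := ha₁.trans_le hab₁
  -- The 2 undoes the threshold λ/2 and b₁ comes from the upper bound on τ. Of the 5, 4 is the tail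
  -- exponent and 1 belongs to the moment term 1 + a₁⁻².
  refine ⟨2 * b₁ * (5 + a₁⁻¹ ^ 2), by positivity, fun γ hγ => ?_⟩
  have hξ : 0 ≤ (2 * γ + 5) / (2 * γ - 5) := div_nonneg (by linarith) (by linarith)
  have hK : 0 < 4 * (γ + 3 / 2) := by linarith
  refine ⟨(1 + (2 * γ + 5) / (2 * γ - 5)) * (4 * (γ + 3 / 2)) + 1, by positivity,
    fun b₂ hb₂ => ?_⟩
  have hb₂' : 0 < b₂ := lt_of_lt_of_le (by positivity) hb₂
  refine ⟨(1 + (2 * γ + 5) / (2 * γ - 5)) * (4 * (γ + 3 / 2)) * b₂, by positivity, ?_⟩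
  intro n p q r su sv m X Astar Ω _ μ _ E δ τ lam η κl κu hX hA hm hδ hE hτ hτa hτb hla hlb hκ _
    hη _ G B
  -- The upper bound on the positive τ excludes the degenerate cases n = 0, zero noise level and
  -- log(pq) = 0.
  have hT : 0 < RobustRRR.tauOrder n p q δ (RobustRRR.noiseLevel μ E δ) :=
    pos_of_mul_pos_right (hτ.trans_le hτb) hb₁.le
  obtain ⟨hn, hv, hL⟩ :=
    RobustRRR.pos_of_tauOrder_pos hδ (RobustRRR.noiseLevel_nonneg μ E δ) hT
  have hrate := RobustRRR.mul_rate_eq hδ hn hv hL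
  have hmom := RobustRRR.mul_rpow_neg_le ha₁ hδ hn hv hL hτa
  set R := RobustRRR.rate n p q δ (RobustRRR.noiseLevel μ E δ)
  set T := RobustRRR.tauOrder n p q δ (RobustRRR.noiseLevel μ E δ)
  set L := Real.log ((p : ℝ) * q) with hLdef
  have hR : 0 < R := pos_of_mul_pos_right (by rw [hrate]; positivity) hn.le
  have hlam : 0 < lam := lt_of_lt_of_le (by positivity) hla
  have hdev : 4 * L + n * (RobustRRR.noiseLevel μ E δ * τ ^ (-min (1 + δ) 2)) ≤
      τ⁻¹ * (n * (lam / 2)) := by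
    have h1 : (5 + a₁⁻¹ ^ 2) * L * τ ≤ n * (lam / 2) :=
      calc (5 + a₁⁻¹ ^ 2) * L * τ ≤ (5 + a₁⁻¹ ^ 2) * L * (b₁ * T) := by gcongr
        _ = n * (2 * b₁ * (5 + a₁⁻¹ ^ 2) * R / 2) := by
          linear_combination -(5 + a₁⁻¹ ^ 2) * b₁ * hrate
        _ ≤ n * (lam / 2) := by gcongr
    rw [inv_mul_eq_div, le_div_iff₀ hτ]
    refine le_trans (mul_le_mul_of_nonneg_right ?_ hτ.le) h1
    linarith
  have hprob := RobustRRR.measure_score_gt_le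
    (fun i j => hX.2 ⟨(i, j), rfl⟩) hE hδ (by exact_mod_cast hn) hτ hdev
  have hsub : G ∩ B ⊆ {ω | ∃ j k, lam / 2 < |RobustRRR.score X (E ω) τ j k|} := by
    rintro ω ⟨hG, Ahat, hest, hnot⟩
    change ∃ j k, lam / 2 < |RobustRRR.score X (E ω) τ j k|
    by_contra! hscore
    obtain ⟨hF, h11⟩ := RobustRRR.estimator_bounds hτ hlam hγ hκ hscore hm
      (RobustRRR.LocalizedRE.le_rayleigh hG) hη hest
    exact hnot (RobustRRR.errorBounds_of_bounds hK.le hξ hκ hlam hlb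
      (RobustRRR.card_supp_le hA) hF h11)
  have hN : (p : ℝ) * q * (2 * Real.exp (-(4 * L))) ≤ ((p : ℝ) * q)⁻¹ * ((p : ℝ) * q)⁻¹ := by
    have := RobustRRR.two_mul_exp_neg_four_mul_log_le (N := p * q) (by push_cast; exact hL)
    push_cast at this
    exact this
  have hmain : μ (G ∩ B) ≤
      ENNReal.ofReal (((p : ℝ) * q)⁻¹) * ENNReal.ofReal (((p : ℝ) * q)⁻¹) := by
    rw [← ENNReal.ofReal_mul (by positivity)]
    exact (measure_mono hsub).trans (hprob.trans (ENNReal.ofReal_le_ofReal hN))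
  -- One of the two factors (pq)⁻¹ is bounded by 1 for the first claim, and by the probability of G
  -- for the conditional one.
  refine ⟨hmain.trans (mul_le_of_le_one_left zero_le ?_), fun h =>
    hmain.trans (mul_le_mul_right h _)⟩
  rw [ENNReal.ofReal_le_one]
  have := Nat.cast_inv_le_one (α := ℝ) (p * q)
  push_cast at this
  simpa using this
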